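/- For every $\varepsilon>0$ there is a constant $C_\varepsilon>0$ such that for every real-valued $W\in L^2(\mathbb{R}^3)$ whose Fourier transform $\widehat W(k)=\int_{\mathbb{R}^3}W(x)e^{-ik\cdot x}\,dx$ (understood in the $L^2$ sense) belongs to $L^\infty(\mathbb{R}^3)$, the two operator inequalities $$\pm W(x-y)\le C_\varepsilon\,\|\widehat W\|_{L^\infty(\mathbb{R}^3)}\,(1-\Delta_x)^{3/4+\varepsilon}\otimes(1-\Delta_y)^{3/4+\varepsilon}$$ hold on $L^2(\mathbb{R}^3\times\mathbb{R}^3)$. The constant $C_\varepsilon$ depends only on $\varepsilon$ and not on $W$. Here $W(x-y)$ is the multiplication operator by this function, $(1-\Delta_x)^{s}\otimes(1-\Delta_y)^{s}$ is the Fourier multiplier with symbol $(1+|p|^2)^{s}(1+|q|^2)^{s}$ (with $p,q$ the variables dual to $x,y$), and the inequalities are meant in the sense of quadratic forms: with $s=3/4+\varepsilon$, for every $\psi\in L^2(\mathbb{R}^3\times\mathbb{R}^3)$ in the form domain of $(1-\Delta_x)^{s}\otimes(1-\Delta_y)^{s}$ the function $W(x-y)|\psi(x,y)|^2$ is integrable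 and $$\pm\iint W(x-y)|\psi(x,y)|^2\,dx\,dy\le C_\varepsilon\,\|\widehat W\|_{L^\infty(\mathbb{R}^3)}\,\big\langle\psi,(1-\Delta_x)^{s}\otimes(1-\Delta_y)^{s}\psi\big\rangle ,$$ the last bracket denoting the quadratic form. -/

import Mathlib

open MeasureTheory
open scoped FourierTransform ENNReal

/-- The configuration space `ℝ³` of one particle. -/
abbrev R3 : Type := EuclideanSpace ℝ (Fin 3)

/-- The configuration space `ℝ³ × ℝ³` of two particles `z = (x, y)`, with its Euclidean structure
(and hence Lebesgue measure, the product of the two Lebesgue measures). -/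
abbrev R3xR3 : Type := WithLp 2 (R3 × R3)

/-- The Hilbert space `L²(ℝ³ × ℝ³; ℂ) = L²(ℝ³) ⊗ L²(ℝ³)` of two-particle wave functions. -/
abbrev TwoBody : Type := Lp ℂ 2 (volume : Measure R3xR3)

/-- A real quadratic form on the two-particle space together with its form domain. -/
structure TwoBodyForm where
  dom : Set TwoBody
  val : TwoBody → ℝ

namespace TwoBodyForm

/-- The operator inequality `A ≤ B` in the sense of quadratic forms: `Q(B) ⊆ Q(A)` and
`⟨ψ, A ψ⟩ ≤ ⟨ψ, B ψ⟩` for every `ψ ∈ Q(B)`. -/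
def OpLE (A B : TwoBodyForm) : Prop :=
  ∀ ψ ∈ B.dom, ψ ∈ A.dom ∧ A.val ψ ≤ B.val ψ

/-- The form `c A` with the form domain of `A`. -/
def scale (c : ℝ) (A : TwoBodyForm) : TwoBodyForm where
  dom := A.dom
  val := fun ψ => c * A.val ψ

/-- The quadratic form of the self-adjoint operator of multiplication by the real function `V`:
the form domain is `{ψ ∈ L² : ∫ |V| |ψ|² < ∞}` and the value is `∫ V |ψ|²`. -/
noncomputable def multiplication (V : R3xR3 → ℝ) : TwoBodyForm where
  dom := {ψ | Integrable (fun z => V z * ‖ψ z‖ ^ 2) volume}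
  val := fun ψ => ∫ z, V z * ‖ψ z‖ ^ 2

/-- The quadratic form of the Fourier multiplier `𝓕⁻¹ m 𝓕` with the real symbol `m`, i.e. of the
self-adjoint operator which is unitarily equivalent, through the Fourier transform of
`L²(ℝ³ × ℝ³)`, to the multiplication by `m`. -/
noncomputable def fourierMultiplier (m : R3xR3 → ℝ) : TwoBodyForm where
  dom := {ψ | 𝓕 ψ ∈ (multiplication m).dom}
  val := fun ψ => (multiplication m).val (𝓕 ψ)

end TwoBodyForm

/-- The symbol of `(1 - Δ)^s` on `ℝ³`. With the Fourier transform `∫ f(x) e^{-2πi⟨x, ξ⟩} dx`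
the operator `-Δ` is the multiplication by `(2π|ξ|)²`. -/
noncomputable def oneSubLaplacianPowSymbol (s : ℝ) (ξ : R3) : ℝ :=
  (1 + (2 * Real.pi * ‖ξ‖) ^ 2) ^ s

/-- The (form of the) operator `(1 - Δ_x)^s ⊗ (1 - Δ_y)^t` on `L²(ℝ³) ⊗ L²(ℝ³) = L²(ℝ³ × ℝ³)`:
the tensor product of two Fourier multipliers is the Fourier multiplier with the product symbol
`(ξ, η) ↦ a(ξ) b(η)`. -/
noncomputable def oneSubLaplacianPowTensor (s t : ℝ) : TwoBodyForm :=
  TwoBodyForm.fourierMultiplier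
    (fun ζ => oneSubLaplacianPowSymbol s ζ.fst * oneSubLaplacianPowSymbol t ζ.snd)

/-- The (form of the) pair interaction: multiplication by `W(x - y)`. -/
noncomputable def pairInteraction (W : R3 → ℝ) : TwoBodyForm :=
  TwoBodyForm.multiplication (fun z => W (z.fst - z.snd))

/-- The Fourier transform in `L²(ℝ³)` of a real square-integrable function. -/
noncomputable def fourierL2 (W : R3 → ℝ) (hW : MemLp W 2 (volume : Measure R3)) :
    Lp ℂ 2 (volume : Measure R3) :=
  𝓕 (MemLp.toLp (fun x => (W x : ℂ)) hW.ofReal)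

open scoped NNReal

/-!
Let `ρ` be the density of the law of `x - y` under `|ψ(x, y)|² dx dy`, so that the interaction
energy is `∫ W ρ` and Plancherel bounds it by `‖Ŵ‖_∞ ‖ρ̂‖₁`. Now `ρ̂(k)` is the correlation
`∫∫ conj(ψ̂(p, q)) ψ̂(p + k, q - k) dp dq`. The shift `(k, -k)` preserves the total momentum
`P = p + q`, hence integrating over `k` decouples the two factors:
`‖ρ̂‖₁ ≤ ∫ (∫ |ψ̂(p, P - p)| dp)² dP`. Cauchy–Schwarz in `p` with a weight `w` bounds this by
`K ∫∫ w |ψ̂|²`, where `K = sup_P ∫ w(p, P - p)⁻¹ dp`. For `w(p, q) = (1 + |p|²)^s (1 + |q|²)^t`,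
`w⁻¹` is at most the power `-(s + t)` of the smaller of `1 + |p|²` and `1 + |q|²`, so `K` is finite
as soon as `2 (s + t)` exceeds the dimension.
-/

lemma memLp_two_of_integrable_of_norm_le {α F : Type*} [MeasurableSpace α] {μ : Measure α}
    [NormedAddCommGroup F] {f : α → F} {c : ℝ} (hf : Integrable f μ) (hc : ∀ᵐ x ∂μ, ‖f x‖ ≤ c) :
    MemLp f 2 μ := by
  rw [memLp_two_iff_integrable_sq_norm hf.aestronglyMeasurable]
  simpa only [sq] using
    hf.norm.bdd_mul hf.aestronglyMeasurable.norm (by simpa only [norm_norm] using hc)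

lemma ae_norm_le_toReal_eLpNorm_top {α F : Type*} [MeasurableSpace α] {μ : Measure α}
    [NormedAddCommGroup F] {f : α → F} (hf : eLpNorm f ∞ μ ≠ ∞) :
    ∀ᵐ x ∂μ, ‖f x‖ ≤ (eLpNorm f ∞ μ).toReal := by
  rw [eLpNorm_exponent_top] at hf ⊢
  filter_upwards [ae_le_eLpNormEssSup (f := f) (μ := μ)] with x hx
  simpa only [toReal_enorm] using ENNReal.toReal_mono hf hx

section FourierTransform

open SchwartzMap

variable {V F : Type*} [NormedAddCommGroup V] [InnerProductSpace ℝ V] [FiniteDimensional ℝ V]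
  [MeasurableSpace V] [BorelSpace V] [NormedAddCommGroup F]

section NormedSpace

variable [NormedSpace ℂ F]

lemma memLp_two_fourier_of_integrable_fourier {f : V → F} (hF : Integrable (𝓕 f)) :
    MemLp (𝓕 f) 2 :=
  memLp_two_of_integrable_of_norm_le hF
    (.of_forall (VectorFourier.norm_fourierIntegral_le_integral_norm _ _ _ f))

variable [CompleteSpace F]

lemma ae_eq_of_forall_integral_schwartz_smul_eq {f g : V → F} (hf : LocallyIntegrable f)
    (hg : LocallyIntegrable g) (h : ∀ φ : 𝓢(V, ℂ), ∫ x, φ x • f x = ∫ x, φ x • g x) :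
    f =ᵐ[volume] g := by
  refine ae_eq_of_integral_contDiff_smul_eq hf hg fun φ hφ hsupp => ?_
  have hsupp' : HasCompactSupport fun x => (φ x : ℂ) := hsupp.comp_left Complex.ofReal_zero
  exact h (hsupp'.toSchwartzMap (Complex.ofRealCLM.contDiff.comp hφ))

lemma integral_fourier_schwartz_smul_of_integrable (φ : 𝓢(V, ℂ)) {f : V → F}
    (hf : Integrable f) : ∫ x, 𝓕 φ x • f x = ∫ ξ, φ ξ • 𝓕 f ξ := by
  simpa [fourier_coe] using! VectorFourier.integral_bilin_fourierIntegral_eq_flip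
    (.lsmul ℂ ℂ) (L := innerₗ V) Real.continuous_fourierChar continuous_inner φ.integrable hf

end NormedSpace

variable [InnerProductSpace ℂ F] [CompleteSpace F]

lemma integral_fourier_schwartz_smul_Lp (φ : 𝓢(V, ℂ)) (f : Lp F 2 (volume : Measure V)) :
    ∫ x, 𝓕 φ x • f x = ∫ ξ, φ ξ • 𝓕 f ξ := by
  have h := congrArg (fun T : 𝓢'(V, F) => T φ) (Lp.fourier_toTemperedDistribution_eq f)
  simp only [TemperedDistribution.fourier_apply, Lp.toTemperedDistribution_apply] at h
  exact h

lemma fourierInv_toLp_fourier_ae_eq {f : V → F} (hf : Integrable f) (hF : MemLp (𝓕 f) 2) :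
    (𝓕⁻ (hF.toLp (𝓕 f)) : Lp F 2 (volume : Measure V)) =ᵐ[volume] f := by
  refine ae_eq_of_forall_integral_schwartz_smul_eq ((Lp.memLp _).locallyIntegrable one_le_two)
    hf.locallyIntegrable fun φ => ?_
  have hφ : φ = 𝓕 (𝓕⁻ φ) := (FourierTransform.fourier_fourierInv_eq φ).symm
  rw [hφ, integral_fourier_schwartz_smul_Lp, integral_fourier_schwartz_smul_of_integrable _ hf,
    FourierTransform.fourier_fourierInv_eq]
  refine integral_congr_ae ?_
  filter_upwards [hF.coeFn_toLp] with ξ hξ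
  rw [hξ]

lemma integrable_inner_of_memLp_two_fourier {f : V → F} (hf : Integrable f)
    (hF : MemLp (𝓕 f) 2) (g : Lp F 2 (volume : Measure V)) :
    Integrable fun x => inner ℂ (f x) (g x) := by
  refine (integrable_congr ?_).mp (L2.integrable_inner (𝓕⁻ (hF.toLp (𝓕 f))) g)
  filter_upwards [fourierInv_toLp_fourier_ae_eq hf hF] with x hx
  rw [hx]

theorem integral_inner_eq_integral_inner_fourier {f : V → F} (hf : Integrable f)
    (hF : MemLp (𝓕 f) 2) (g : Lp F 2 (volume : Measure V)) :
    ∫ x, inner ℂ (f x) (g x) = ∫ ξ, inner ℂ (𝓕 f ξ) (𝓕 g ξ) := by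
  set G : Lp F 2 (volume : Measure V) := hF.toLp (𝓕 f)
  calc ∫ x, inner ℂ (f x) (g x)
    _ = inner ℂ (𝓕⁻ G) g := by
      rw [L2.inner_def]
      refine integral_congr_ae ?_
      filter_upwards [fourierInv_toLp_fourier_ae_eq hf hF] with x hx
      rw [hx]
    _ = inner ℂ G (𝓕 g) := by
      rw [← Lp.inner_fourier_eq, FourierTransform.fourier_fourierInv_eq]
    _ = ∫ ξ, inner ℂ (𝓕 f ξ) (𝓕 g ξ) := by
      rw [L2.inner_def]
      refine integral_congr_ae ?_
      filter_upwards [hF.coeFn_toLp] with ξ hξ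
      rw [hξ]

theorem norm_integral_inner_le_mul_integral_norm_fourier {f : V → F} (hf : Integrable f)
    (hF : Integrable (𝓕 f)) (g : Lp F 2 (volume : Measure V)) {M : ℝ}
    (hg : ∀ᵐ ξ, ‖𝓕 g ξ‖ ≤ M) :
    ‖∫ x, inner ℂ (f x) (g x)‖ ≤ M * ∫ ξ, ‖𝓕 f ξ‖ := by
  rw [integral_inner_eq_integral_inner_fourier hf (memLp_two_fourier_of_integrable_fourier hF),
    ← integral_const_mul]
  refine norm_integral_le_of_norm_le (hF.norm.const_mul M) ?_
  filter_upwards [hg] with ξ hξ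
  grw [norm_inner_le_norm, hξ, mul_comm]

lemma fourier_ae_eq_of_modulation {f g : Lp F 2 (volume : Measure V)} {a : V}
    (h : g =ᵐ[volume] fun x => Real.fourierChar (-inner ℝ a x) • f x) :
    (fun ξ => 𝓕 g ξ) =ᵐ[volume]
      fun ξ => 𝓕 f (ξ + a) := by
  have hloc : LocallyIntegrable fun ξ => 𝓕 f (ξ + a) :=
    ((Lp.memLp (𝓕 f)).comp_measurePreserving
      (measurePreserving_add_right volume a)).locallyIntegrable one_le_two
  refine ae_eq_of_forall_integral_schwartz_smul_eq ((Lp.memLp _).locallyIntegrable one_le_two)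
    hloc fun φ => ?_
  set φa : 𝓢(V, ℂ) := compSubConstCLM ℂ a φ
  have hφa (x : V) : 𝓕 φa x = Real.fourierChar (-inner ℝ a x) • 𝓕 φ x := by
    have h := congrFun
      (VectorFourier.fourierIntegral_comp_add_right Real.fourierChar volume (innerₗ V) φ (-a)) x
    have hcomp : φ ∘ (· + -a) = φa := funext fun v => congrArg φ (sub_eq_add_neg v a).symm
    rwa [hcomp, innerₗ_apply_apply, inner_neg_left] at h
  calc ∫ ξ, φ ξ • 𝓕 g ξ
    _ = ∫ x, 𝓕 φ x • g x := (integral_fourier_schwartz_smul_Lp φ g).symm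
    _ = ∫ x, 𝓕 φa x • f x := by
      refine integral_congr_ae ?_
      filter_upwards [h] with x hx
      rw [hx, hφa, smul_comm, smul_assoc]
    _ = ∫ ξ, φ (ξ - a) • 𝓕 f ξ :=
      integral_fourier_schwartz_smul_Lp φa f
    _ = ∫ ξ, φ ξ • 𝓕 f (ξ + a) := by
      rw [← integral_add_right_eq_self _ a]
      simp only [add_sub_cancel_right]

theorem fourier_inner_eq_integral_inner_fourier (f g : Lp F 2 (volume : Measure V)) (a : V) :
    𝓕 (fun x => inner ℂ (f x) (g x)) a = ∫ ξ, inner ℂ (𝓕 f ξ) (𝓕 g (ξ + a)) := by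
  have hmod : MemLp (fun x => Real.fourierChar (-inner ℝ a x) • g x) 2 := by
    refine (memLp_congr_norm (Lp.memLp g).1 ?_ ?_).mp (Lp.memLp g)
    · have hcont : Continuous fun x => (Real.fourierChar (-inner ℝ a x) : Circle) := by fun_prop
      exact hcont.aestronglyMeasurable.smul (Lp.memLp g).1
    · exact .of_forall fun x => (Circle.norm_smul _ _).symm
  calc 𝓕 (fun x => inner ℂ (f x) (g x)) a
    _ = ∫ x, inner ℂ (f x) (Real.fourierChar (-inner ℝ a x) • g x) := by
      rw [Real.fourier_eq]
      refine integral_congr_ae (.of_forall fun x => ?_)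
      simp only [real_inner_comm a x, Circle.smul_def, inner_smul_right, smul_eq_mul]
    _ = inner ℂ f (hmod.toLp _) := by
      rw [L2.inner_def]
      refine integral_congr_ae ?_
      filter_upwards [hmod.coeFn_toLp] with x hx
      rw [hx]
    _ = inner ℂ (𝓕 f) (𝓕 (hmod.toLp _)) := (Lp.inner_fourier_eq _ _).symm
    _ = ∫ ξ, inner ℂ (𝓕 f ξ) (𝓕 g (ξ + a)) := by
      rw [L2.inner_def]
      refine integral_congr_ae ?_
      filter_upwards [fourier_ae_eq_of_modulation hmod.coeFn_toLp] with ξ hξ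
      rw [hξ]

end FourierTransform

section Correlation

lemma sq_lintegral_le_lintegral_inv_mul_lintegral_mul_sq {α : Type*} [MeasurableSpace α]
    {μ : Measure α} {f w : α → ℝ≥0∞} (hf : AEMeasurable f μ) (hw : AEMeasurable w μ)
    (hw0 : ∀ x, w x ≠ 0) (hwt : ∀ x, w x ≠ ∞) :
    (∫⁻ x, f x ∂μ) ^ 2 ≤ (∫⁻ x, (w x)⁻¹ ∂μ) * ∫⁻ x, w x * f x ^ 2 ∂μ := by
  have hsqrt (x : ℝ≥0∞) : (x ^ (1 / 2 : ℝ)) ^ 2 = x := by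
    rw [← ENNReal.rpow_natCast, ← ENNReal.rpow_mul]; norm_num
  have hfac (x : α) : f x = (w x)⁻¹ ^ (1 / 2 : ℝ) * (w x * f x ^ 2) ^ (1 / 2 : ℝ) := by
    rw [← ENNReal.mul_rpow_of_nonneg _ _ (by norm_num), ← mul_assoc,
      ENNReal.inv_mul_cancel (hw0 x) (hwt x), one_mul, ← ENNReal.rpow_natCast, ← ENNReal.rpow_mul]
    norm_num
  have hCS := ENNReal.lintegral_mul_norm_pow_le (p := 1 / 2) (q := 1 / 2) hw.inv
    (hw.mul (hf.pow_const 2)) (by norm_num) (by norm_num) (by norm_num)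
  simp only [← hfac, Pi.inv_apply, Pi.mul_apply] at hCS
  grw [hCS, mul_pow, hsqrt, hsqrt]

variable {G : Type*} [AddCommGroup G] [MeasurableSpace G] [MeasurableAdd₂ G] [MeasurableSub₂ G]
  {ν : Measure G} [SFinite ν] [ν.IsAddLeftInvariant]

lemma lintegral_lintegral_mul_opposite_shift {a : G × G → ℝ≥0∞} (ha : Measurable a) :
    ∫⁻ k, ∫⁻ z, a z * a (z.1 + k, z.2 - k) ∂(ν.prod ν) ∂ν =
      ∫⁻ P, (∫⁻ p, a (p, P - p) ∂ν) ^ 2 ∂ν := by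
  calc ∫⁻ k, ∫⁻ z, a z * a (z.1 + k, z.2 - k) ∂(ν.prod ν) ∂ν
    _ = ∫⁻ k, ∫⁻ p, ∫⁻ q, a (p, q) * a (p + k, q - k) ∂ν ∂ν ∂ν := by
      refine lintegral_congr fun k => ?_
      rw [lintegral_prod _ (by fun_prop)]
    _ = ∫⁻ p, ∫⁻ k, ∫⁻ q, a (p, q) * a (p + k, q - k) ∂ν ∂ν ∂ν :=
      lintegral_lintegral_swap (Measurable.lintegral_prod_right (by fun_prop)).aemeasurable
    _ = ∫⁻ p, ∫⁻ k, ∫⁻ P, a (p, P - p) * a (p + k, P - (p + k)) ∂ν ∂ν ∂ν := by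
      refine lintegral_congr fun p => lintegral_congr fun k => ?_
      rw [← lintegral_sub_right_eq_self _ p]
      simp only [sub_sub]
    _ = ∫⁻ p, ∫⁻ P, a (p, P - p) * ∫⁻ p', a (p', P - p') ∂ν ∂ν ∂ν := by
      refine lintegral_congr fun p => ?_
      rw [lintegral_lintegral_swap (by fun_prop)]
      refine lintegral_congr fun P => ?_
      rw [lintegral_const_mul _ (by fun_prop),
        lintegral_add_left_eq_self (fun p' => a (p', P - p')) p]
    _ = ∫⁻ P, ∫⁻ p, a (p, P - p) * ∫⁻ p', a (p', P - p') ∂ν ∂ν ∂ν := by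
      refine lintegral_lintegral_swap (Measurable.mul (by fun_prop) ?_).aemeasurable
      exact Measurable.lintegral_prod_right' (f := fun z : (G × G) × G => a (z.2, z.1.2 - z.2))
        (by fun_prop)
    _ = ∫⁻ P, (∫⁻ p, a (p, P - p) ∂ν) ^ 2 ∂ν := by
      refine lintegral_congr fun P => ?_
      rw [lintegral_mul_const _ (by fun_prop), sq]

lemma lintegral_lintegral_sub_eq_lintegral_prod {b : G × G → ℝ≥0∞} (hb : Measurable b) :
    ∫⁻ P, ∫⁻ p, b (p, P - p) ∂ν ∂ν = ∫⁻ z, b z ∂(ν.prod ν) := by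
  rw [lintegral_lintegral_swap (by fun_prop), lintegral_prod _ (by fun_prop)]
  exact lintegral_congr fun p => lintegral_sub_right_eq_self (fun q => b (p, q)) p

theorem lintegral_lintegral_mul_opposite_shift_le {a w : G × G → ℝ≥0∞} (ha : Measurable a)
    (hw : Measurable w) (hw0 : ∀ z, w z ≠ 0) (hwt : ∀ z, w z ≠ ∞) {K : ℝ≥0∞}
    (hK : ∀ P, ∫⁻ p, (w (p, P - p))⁻¹ ∂ν ≤ K) :
    ∫⁻ k, ∫⁻ z, a z * a (z.1 + k, z.2 - k) ∂(ν.prod ν) ∂ν ≤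
      K * ∫⁻ z, w z * a z ^ 2 ∂(ν.prod ν) := by
  calc ∫⁻ k, ∫⁻ z, a z * a (z.1 + k, z.2 - k) ∂(ν.prod ν) ∂ν
    _ = ∫⁻ P, (∫⁻ p, a (p, P - p) ∂ν) ^ 2 ∂ν := lintegral_lintegral_mul_opposite_shift ha
    _ ≤ ∫⁻ P, K * ∫⁻ p, w (p, P - p) * a (p, P - p) ^ 2 ∂ν ∂ν := by
      refine lintegral_mono fun P => ?_
      grw [sq_lintegral_le_lintegral_inv_mul_lintegral_mul_sq (w := fun p => w (p, P - p))
        (by fun_prop) (by fun_prop) (fun _ => hw0 _) (fun _ => hwt _), hK P]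
    _ = K * ∫⁻ z, w z * a z ^ 2 ∂(ν.prod ν) := by
      rw [lintegral_const_mul _ (Measurable.lintegral_prod_right (by fun_prop)),
        lintegral_lintegral_sub_eq_lintegral_prod (b := fun z => w z * a z ^ 2) (by fun_prop)]

end Correlation

section ObservableDensity

variable {α β F H : Type*} [MeasurableSpace α] [MeasurableSpace β] {μ : Measure α} {ν : Measure β}
  [NormedAddCommGroup F] [NormedAddCommGroup H] [NormedSpace ℝ H]

/-- The law `‖ψ‖² dμ` of the position in the (not necessarily normalized) state `ψ`. -/
noncomputable def positionMeasure (ψ : Lp F 2 μ) : Measure α :=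
  μ.withDensity fun z => ‖ψ z‖ₑ ^ 2

instance isFiniteMeasure_positionMeasure (ψ : Lp F 2 μ) :
    IsFiniteMeasure (positionMeasure ψ) := by
  refine isFiniteMeasure_withDensity ?_
  have h := lintegral_rpow_enorm_lt_top_of_eLpNorm_lt_top two_ne_zero ENNReal.ofNat_ne_top
    (Lp.memLp ψ).2
  simpa using h.ne

/-- The density with respect to `ν` of the law of the observable `X` in the state `ψ`. -/
noncomputable def observableDensity (ψ : Lp F 2 μ) (X : α → β) (ν : Measure β) (u : β) : ℝ :=
  (pdf X (positionMeasure ψ) ν u).toReal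

lemma measurable_enorm_coeFn_sq (ψ : Lp F 2 μ) : Measurable fun z => ‖ψ z‖ₑ ^ 2 :=
  (Lp.stronglyMeasurable ψ).enorm.pow_const 2

variable {X : α → β} [SigmaFinite ν]

lemma hasPDF_positionMeasure (ψ : Lp F 2 μ) (hX : Measure.QuasiMeasurePreserving X μ ν) :
    HasPDF X (positionMeasure ψ) ν := by
  have hac : positionMeasure ψ ≪ μ := withDensity_absolutelyContinuous _ _
  exact hasPDF_iff.mpr ⟨hX.measurable.aemeasurable, inferInstance,
    (hac.map hX.measurable).trans hX.absolutelyContinuous⟩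

lemma integrable_observableDensity_smul_iff (ψ : Lp F 2 μ)
    (hX : Measure.QuasiMeasurePreserving X μ ν) {f : β → H} (hf : AEStronglyMeasurable f ν) :
    Integrable (fun u => observableDensity ψ X ν u • f u) ν ↔
      Integrable (fun z => ‖ψ z‖ ^ 2 • f (X z)) μ := by
  have := hasPDF_positionMeasure ψ hX
  unfold observableDensity
  rw [pdf.integrable_pdf_smul_iff hf, positionMeasure,
    integrable_withDensity_iff_integrable_smul' (measurable_enorm_coeFn_sq ψ)
      (.of_forall fun z => by simp)]
  simp only [ENNReal.toReal_pow, toReal_enorm]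

lemma integral_observableDensity_smul (ψ : Lp F 2 μ)
    (hX : Measure.QuasiMeasurePreserving X μ ν) {f : β → H} (hf : AEStronglyMeasurable f ν) :
    ∫ u, observableDensity ψ X ν u • f u ∂ν = ∫ z, ‖ψ z‖ ^ 2 • f (X z) ∂μ := by
  have := hasPDF_positionMeasure ψ hX
  unfold observableDensity
  rw [pdf.integral_pdf_smul hf, positionMeasure,
    integral_withDensity_eq_integral_toReal_smul (measurable_enorm_coeFn_sq ψ)
      (.of_forall fun z => by simp)]
  simp only [ENNReal.toReal_pow, toReal_enorm]

lemma integrable_observableDensity (ψ : Lp F 2 μ) (hX : Measure.QuasiMeasurePreserving X μ ν) :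
    Integrable (observableDensity ψ X ν) ν := by
  simpa using (integrable_observableDensity_smul_iff ψ hX (f := fun _ => (1 : ℝ))
    aestronglyMeasurable_const).mpr (by simpa using (Lp.memLp ψ).integrable_norm_pow two_ne_zero)

end ObservableDensity

section RelativePosition

variable {E F : Type*} [NormedAddCommGroup E] [InnerProductSpace ℝ E] [FiniteDimensional ℝ E]
  [MeasurableSpace E] [BorelSpace E] [NormedAddCommGroup F]

/-- The density of the law of the relative position `x - y` in the two-body state `ψ`. -/
noncomputable def relativePositionDensity (ψ : Lp F 2 (volume : Measure (WithLp 2 (E × E)))) :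
    E → ℝ :=
  observableDensity ψ (fun z => z.fst - z.snd) volume

lemma quasiMeasurePreserving_relativePosition :
    Measure.QuasiMeasurePreserving (fun z : WithLp 2 (E × E) => z.fst - z.snd) volume volume :=
  (quasiMeasurePreserving_sub_of_right_invariant volume volume).comp
    (WithLp.volume_preserving_ofLp E E).quasiMeasurePreserving

lemma integrable_relativePositionDensity (ψ : Lp F 2 (volume : Measure (WithLp 2 (E × E)))) :
    Integrable (relativePositionDensity ψ) :=
  integrable_observableDensity ψ quasiMeasurePreserving_relativePosition

lemma inner_relativePositionDensity_ae_eq (ψ : Lp F 2 (volume : Measure (WithLp 2 (E × E))))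
    {W : E → ℂ} (hW : MemLp W 2) :
    (fun u => inner ℂ (relativePositionDensity ψ u : ℂ) (hW.toLp W u)) =ᵐ[volume]
      fun u => relativePositionDensity ψ u • W u := by
  filter_upwards [hW.coeFn_toLp] with u hu
  simp [hu, mul_comm]

lemma integrable_inner_relativePositionDensity_iff
    (ψ : Lp F 2 (volume : Measure (WithLp 2 (E × E)))) {W : E → ℂ} (hW : MemLp W 2) :
    Integrable (fun u => inner ℂ (relativePositionDensity ψ u : ℂ) (hW.toLp W u)) ↔
      Integrable fun z : WithLp 2 (E × E) => W (z.fst - z.snd) * ‖ψ z‖ ^ 2 := by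
  rw [integrable_congr (inner_relativePositionDensity_ae_eq ψ hW)]
  simpa only [relativePositionDensity, Complex.real_smul, Complex.ofReal_pow, mul_comm] using
    integrable_observableDensity_smul_iff ψ quasiMeasurePreserving_relativePosition hW.1

lemma integral_inner_relativePositionDensity
    (ψ : Lp F 2 (volume : Measure (WithLp 2 (E × E)))) {W : E → ℂ} (hW : MemLp W 2) :
    ∫ u, inner ℂ (relativePositionDensity ψ u : ℂ) (hW.toLp W u) =
      ∫ z : WithLp 2 (E × E), W (z.fst - z.snd) * ‖ψ z‖ ^ 2 := by
  rw [integral_congr_ae (inner_relativePositionDensity_ae_eq ψ hW)]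
  simpa only [relativePositionDensity, Complex.real_smul, Complex.ofReal_pow, mul_comm] using
    integral_observableDensity_smul ψ quasiMeasurePreserving_relativePosition hW.1

variable [InnerProductSpace ℂ F] [CompleteSpace F]

lemma fourier_relativePositionDensity (ψ : Lp F 2 (volume : Measure (WithLp 2 (E × E)))) (k : E) :
    𝓕 (fun u => (relativePositionDensity ψ u : ℂ)) k =
      ∫ ζ, inner ℂ (𝓕 ψ ζ) (𝓕 ψ (ζ + WithLp.toLp 2 (k, -k))) := by
  have hcont : Continuous fun u : E => (Real.fourierChar (-inner ℝ u k) : ℂ) := by fun_prop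
  have hinner (z : WithLp 2 (E × E)) :
      inner ℝ z (WithLp.toLp 2 (k, -k)) = inner ℝ (z.fst - z.snd) k := by
    rw [WithLp.prod_inner_apply, inner_sub_left, sub_eq_add_neg, ← inner_neg_right]
    rfl
  calc 𝓕 (fun u => (relativePositionDensity ψ u : ℂ)) k
    _ = ∫ u, relativePositionDensity ψ u • (Real.fourierChar (-inner ℝ u k) : ℂ) := by
      rw [Real.fourier_eq]
      refine integral_congr_ae (.of_forall fun u => ?_)
      simp only [Circle.smul_def, smul_eq_mul, Complex.real_smul, mul_comm]
    _ = ∫ z, ‖ψ z‖ ^ 2 • (Real.fourierChar (-inner ℝ (z.fst - z.snd) k) : ℂ) :=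
      integral_observableDensity_smul ψ quasiMeasurePreserving_relativePosition
        hcont.aestronglyMeasurable
    _ = 𝓕 (fun z => inner ℂ (ψ z) (ψ z)) (WithLp.toLp 2 (k, -k)) := by
      rw [Real.fourier_eq]
      refine integral_congr_ae (.of_forall fun z => ?_)
      simp [hinner, inner_self_eq_norm_sq_to_K, Circle.smul_def, mul_comm]
    _ = ∫ ζ, inner ℂ (𝓕 ψ ζ) (𝓕 ψ (ζ + WithLp.toLp 2 (k, -k))) :=
      fourier_inner_eq_integral_inner_fourier ψ ψ _

theorem lintegral_enorm_fourier_relativePositionDensity_le {w : WithLp 2 (E × E) → ℝ≥0∞}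
    (hw : Measurable w) (hw0 : ∀ ζ, w ζ ≠ 0) (hwt : ∀ ζ, w ζ ≠ ∞) {K : ℝ≥0∞}
    (hK : ∀ P, ∫⁻ p, (w (WithLp.toLp 2 (p, P - p)))⁻¹ ≤ K)
    (ψ : Lp F 2 (volume : Measure (WithLp 2 (E × E)))) :
    ∫⁻ k, ‖𝓕 (fun u => (relativePositionDensity ψ u : ℂ)) k‖ₑ ≤
      K * ∫⁻ ζ, w ζ * ‖𝓕 ψ ζ‖ₑ ^ 2 := by
  have hψ : Measurable fun ζ => ‖𝓕 ψ ζ‖ₑ := (Lp.stronglyMeasurable (𝓕 ψ)).enorm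
  have htoLp : MeasurePreserving (WithLp.toLp 2 : E × E → WithLp 2 (E × E)) :=
    WithLp.volume_preserving_toLp E E
  calc ∫⁻ k, ‖𝓕 (fun u => (relativePositionDensity ψ u : ℂ)) k‖ₑ
    _ ≤ ∫⁻ k : E, ∫⁻ ζ, ‖𝓕 ψ ζ‖ₑ * ‖𝓕 ψ (ζ + WithLp.toLp 2 (k, -k))‖ₑ := by
      refine lintegral_mono fun k => ?_
      rw [fourier_relativePositionDensity]
      refine (enorm_integral_le_lintegral_enorm _).trans (lintegral_mono fun ζ => ?_)
      simpa only [ofReal_norm, ENNReal.ofReal_mul (norm_nonneg _)] using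
        ENNReal.ofReal_le_ofReal (norm_inner_le_norm (𝕜 := ℂ) (𝓕 ψ ζ) (𝓕 ψ (ζ + _)))
    _ = ∫⁻ k : E, ∫⁻ z : E × E, ‖𝓕 ψ (WithLp.toLp 2 z)‖ₑ *
          ‖𝓕 ψ (WithLp.toLp 2 (z.1 + k, z.2 - k))‖ₑ := by
      refine lintegral_congr fun k => ?_
      rw [← htoLp.lintegral_comp (by fun_prop)]
      simp only [← WithLp.toLp_add, Prod.add_def, ← sub_eq_add_neg]
    _ ≤ K * ∫⁻ z : E × E, w (WithLp.toLp 2 z) * ‖𝓕 ψ (WithLp.toLp 2 z)‖ₑ ^ 2 :=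
      lintegral_lintegral_mul_opposite_shift_le (hψ.comp htoLp.measurable)
        (hw.comp htoLp.measurable) (fun _ => hw0 _) (fun _ => hwt _) hK
    _ = K * ∫⁻ ζ, w ζ * ‖𝓕 ψ ζ‖ₑ ^ 2 := by
      rw [← htoLp.lintegral_comp (by fun_prop)]

section Weighted

variable {w : WithLp 2 (E × E) → ℝ} {K : ℝ≥0} {ψ : Lp F 2 (volume : Measure (WithLp 2 (E × E)))}

lemma lintegral_enorm_fourier_relativePositionDensity_le_ofReal (hw : Measurable w)
    (hw0 : ∀ ζ, 0 < w ζ)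
    (hK : ∀ P, ∫⁻ p, (ENNReal.ofReal (w (WithLp.toLp 2 (p, P - p))))⁻¹ ≤ K)
    (hψ : Integrable fun ζ => w ζ * ‖𝓕 ψ ζ‖ ^ 2) :
    ∫⁻ k, ‖𝓕 (fun u => (relativePositionDensity ψ u : ℂ)) k‖ₑ ≤
      ENNReal.ofReal (K * ∫ ζ, w ζ * ‖𝓕 ψ ζ‖ ^ 2) := by
  refine (lintegral_enorm_fourier_relativePositionDensity_le hw.ennreal_ofReal
    (fun ζ => (ENNReal.ofReal_pos.mpr (hw0 ζ)).ne') (fun ζ => ENNReal.ofReal_ne_top) hK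
    ψ).trans_eq ?_
  rw [ENNReal.ofReal_mul K.coe_nonneg, ENNReal.ofReal_coe_nnreal,
    ofReal_integral_eq_lintegral_ofReal hψ
      (.of_forall fun ζ => mul_nonneg (hw0 ζ).le (sq_nonneg _))]
  simp only [ENNReal.ofReal_mul (hw0 _).le, ENNReal.ofReal_pow (norm_nonneg _), ofReal_norm]

lemma integrable_fourier_relativePositionDensity (hw : Measurable w) (hw0 : ∀ ζ, 0 < w ζ)
    (hK : ∀ P, ∫⁻ p, (ENNReal.ofReal (w (WithLp.toLp 2 (p, P - p))))⁻¹ ≤ K)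
    (hψ : Integrable fun ζ => w ζ * ‖𝓕 ψ ζ‖ ^ 2) :
    Integrable (𝓕 fun u => (relativePositionDensity ψ u : ℂ)) :=
  ⟨(VectorFourier.fourierIntegral_continuous Real.continuous_fourierChar continuous_inner
      (integrable_relativePositionDensity ψ).ofReal).aestronglyMeasurable,
    (lintegral_enorm_fourier_relativePositionDensity_le_ofReal hw hw0 hK hψ).trans_lt
      ENNReal.ofReal_lt_top⟩

lemma integral_norm_fourier_relativePositionDensity_le (hw : Measurable w) (hw0 : ∀ ζ, 0 < w ζ)
    (hK : ∀ P, ∫⁻ p, (ENNReal.ofReal (w (WithLp.toLp 2 (p, P - p))))⁻¹ ≤ K)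
    (hψ : Integrable fun ζ => w ζ * ‖𝓕 ψ ζ‖ ^ 2) :
    ∫ k, ‖𝓕 (fun u => (relativePositionDensity ψ u : ℂ)) k‖ ≤ K * ∫ ζ, w ζ * ‖𝓕 ψ ζ‖ ^ 2 := by
  have hnonneg : 0 ≤ ∫ ζ, w ζ * ‖𝓕 ψ ζ‖ ^ 2 :=
    integral_nonneg fun ζ => mul_nonneg (hw0 ζ).le (sq_nonneg _)
  rw [integral_norm_eq_lintegral_enorm
    (integrable_fourier_relativePositionDensity hw hw0 hK hψ).aestronglyMeasurable]
  exact ENNReal.toReal_le_of_le_ofReal (mul_nonneg K.coe_nonneg hnonneg)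
    (lintegral_enorm_fourier_relativePositionDensity_le_ofReal hw hw0 hK hψ)

variable {W : E → ℂ}

theorem integrable_relativePosition_mul (hw : Measurable w) (hw0 : ∀ ζ, 0 < w ζ)
    (hK : ∀ P, ∫⁻ p, (ENNReal.ofReal (w (WithLp.toLp 2 (p, P - p))))⁻¹ ≤ K)
    (hW : MemLp W 2) (hψ : Integrable fun ζ => w ζ * ‖𝓕 ψ ζ‖ ^ 2) :
    Integrable fun z : WithLp 2 (E × E) => W (z.fst - z.snd) * ‖ψ z‖ ^ 2 := by
  have hρ : Integrable fun u => (relativePositionDensity ψ u : ℂ) :=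
    (integrable_relativePositionDensity ψ).ofReal
  have hρF := integrable_fourier_relativePositionDensity hw hw0 hK hψ
  rw [← integrable_inner_relativePositionDensity_iff ψ hW]
  exact integrable_inner_of_memLp_two_fourier hρ (memLp_two_fourier_of_integrable_fourier hρF) _

theorem norm_integral_relativePosition_mul_le (hw : Measurable w) (hw0 : ∀ ζ, 0 < w ζ)
    (hK : ∀ P, ∫⁻ p, (ENNReal.ofReal (w (WithLp.toLp 2 (p, P - p))))⁻¹ ≤ K)
    (hW : MemLp W 2) {M : ℝ}
    (hM : ∀ᵐ k, ‖(𝓕 (hW.toLp W) : Lp ℂ 2 (volume : Measure E)) k‖ ≤ M)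
    (hψ : Integrable fun ζ => w ζ * ‖𝓕 ψ ζ‖ ^ 2) :
    ‖∫ z : WithLp 2 (E × E), W (z.fst - z.snd) * ‖ψ z‖ ^ 2‖ ≤
      M * (K * ∫ ζ, w ζ * ‖𝓕 ψ ζ‖ ^ 2) := by
  have hM0 : 0 ≤ M := by
    obtain ⟨k, hk⟩ := hM.exists
    exact (norm_nonneg _).trans hk
  rw [← integral_inner_relativePositionDensity ψ hW]
  grw [norm_integral_inner_le_mul_integral_norm_fourier
      (integrable_relativePositionDensity ψ).ofReal
      (integrable_fourier_relativePositionDensity hw hw0 hK hψ) (hW.toLp W) hM,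
    integral_norm_fourier_relativePositionDensity_le hw hw0 hK hψ]

end Weighted

end RelativePosition

section OneSubLaplacian

lemma rpow_neg_mul_rpow_neg_le {x y s t : ℝ} (hx : 0 < x) (hy : 0 < y) (hs : 0 ≤ s) (ht : 0 ≤ t) :
    x ^ (-s) * y ^ (-t) ≤ x ^ (-(s + t)) + y ^ (-(s + t)) := by
  rw [neg_add, Real.rpow_add hx, Real.rpow_add hy]
  rcases le_total x y with hxy | hyx
  · have : y ^ (-t) ≤ x ^ (-t) := Real.rpow_le_rpow_of_nonpos hx hxy (neg_nonpos.mpr ht)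
    exact le_add_of_le_of_nonneg (by gcongr) (by positivity)
  · have : x ^ (-s) ≤ y ^ (-s) := Real.rpow_le_rpow_of_nonpos hy hyx (neg_nonpos.mpr hs)
    exact le_add_of_nonneg_of_le (by positivity) (by gcongr)

variable {E : Type*} [NormedAddCommGroup E]

/-- The symbol `1 + (2π‖ξ‖)²` of `1 - Δ` on a Euclidean space `E`. -/
noncomputable def oneSubLaplacianSymbol (ξ : E) : ℝ := 1 + (2 * Real.pi * ‖ξ‖) ^ 2

lemma oneSubLaplacianSymbol_pos (ξ : E) : 0 < oneSubLaplacianSymbol ξ := by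
  unfold oneSubLaplacianSymbol
  positivity

lemma one_add_norm_sq_le_oneSubLaplacianSymbol (ξ : E) :
    1 + ‖ξ‖ ^ 2 ≤ oneSubLaplacianSymbol ξ := by
  have hpi : 1 ≤ 2 * Real.pi := by linarith [Real.pi_gt_three]
  unfold oneSubLaplacianSymbol
  gcongr
  exact le_mul_of_one_le_left (norm_nonneg ξ) hpi

variable [MeasurableSpace E] [BorelSpace E]

@[fun_prop]
lemma measurable_oneSubLaplacianSymbol : Measurable (oneSubLaplacianSymbol : E → ℝ) := by
  unfold oneSubLaplacianSymbol
  fun_prop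

variable [InnerProductSpace ℝ E] [FiniteDimensional ℝ E]

lemma lintegral_oneSubLaplacianSymbol_rpow_neg_lt_top {r : ℝ}
    (hr : Module.finrank ℝ E < 2 * r) :
    ∫⁻ ξ : E, ENNReal.ofReal (oneSubLaplacianSymbol ξ ^ (-r)) < ∞ := by
  have hint := integrable_rpow_neg_one_add_norm_sq (E := E) (μ := volume) hr
  refine lt_of_le_of_lt (lintegral_mono fun ξ => ENNReal.ofReal_le_ofReal ?_) hint.lintegral_lt_top
  have hr0 : 0 < 2 * r := (Nat.cast_nonneg _).trans_lt hr
  rw [neg_div, mul_div_cancel_left₀ r two_ne_zero]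
  exact Real.rpow_le_rpow_of_nonpos (by positivity) (one_add_norm_sq_le_oneSubLaplacianSymbol ξ)
    (by linarith only [hr0])

lemma exists_lintegral_inv_oneSubLaplacianSymbol_tensor_le {s t : ℝ} (hs : 0 ≤ s) (ht : 0 ≤ t)
    (hst : Module.finrank ℝ E < 2 * (s + t)) :
    ∃ K : ℝ≥0, 0 < K ∧ ∀ P : E, ∫⁻ p : E, (ENNReal.ofReal
      (oneSubLaplacianSymbol p ^ s * oneSubLaplacianSymbol (P - p) ^ t))⁻¹ ≤ K := by
  set I := ∫⁻ ξ : E, ENNReal.ofReal (oneSubLaplacianSymbol ξ ^ (-(s + t)))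
  have hI : I ≠ ∞ := (lintegral_oneSubLaplacianSymbol_rpow_neg_lt_top hst).ne
  refine ⟨(2 * I).toNNReal + 1, by positivity, fun P => ?_⟩
  rw [ENNReal.coe_add, ENNReal.coe_toNNReal (ENNReal.mul_ne_top ENNReal.ofNat_ne_top hI)]
  have hpos (r : ℝ) (ξ : E) : 0 < oneSubLaplacianSymbol ξ ^ r :=
    Real.rpow_pos_of_pos (oneSubLaplacianSymbol_pos ξ) r
  calc ∫⁻ p : E, (ENNReal.ofReal
        (oneSubLaplacianSymbol p ^ s * oneSubLaplacianSymbol (P - p) ^ t))⁻¹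
    _ ≤ ∫⁻ p : E, (ENNReal.ofReal (oneSubLaplacianSymbol p ^ (-(s + t))) +
          ENNReal.ofReal (oneSubLaplacianSymbol (P - p) ^ (-(s + t)))) := by
      refine lintegral_mono fun p => ?_
      rw [← ENNReal.ofReal_inv_of_pos (mul_pos (hpos _ _) (hpos _ _)), mul_inv,
        ← Real.rpow_neg (oneSubLaplacianSymbol_pos _).le,
        ← Real.rpow_neg (oneSubLaplacianSymbol_pos _).le,
        ← ENNReal.ofReal_add (hpos _ _).le (hpos _ _).le]
      exact ENNReal.ofReal_le_ofReal (rpow_neg_mul_rpow_neg_le (oneSubLaplacianSymbol_pos _)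
        (oneSubLaplacianSymbol_pos _) hs ht)
    _ = 2 * I := by
      rw [lintegral_add_left (by fun_prop), lintegral_sub_left_eq_self
        (fun p => ENNReal.ofReal (oneSubLaplacianSymbol p ^ (-(s + t)))) P, two_mul]
    _ ≤ 2 * I + (1 : ℝ≥0) := le_self_add

end OneSubLaplacian

lemma pairInteraction_opLE_scale_of_norm_integral_le {W : R3 → ℝ} {B : TwoBodyForm} {c : ℝ}
    (h : ∀ ψ ∈ B.dom,
      Integrable (fun z : R3xR3 => (W (z.fst - z.snd) : ℂ) * ‖ψ z‖ ^ 2) ∧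
        ‖∫ z : R3xR3, (W (z.fst - z.snd) : ℂ) * ‖ψ z‖ ^ 2‖ ≤ c * B.val ψ) :
    (pairInteraction W).OpLE (B.scale c) := by
  intro ψ hψ
  obtain ⟨hint, hle⟩ := h ψ hψ
  simp only [← Complex.ofReal_pow, ← Complex.ofReal_mul] at hint hle
  rw [integral_complex_ofReal, Complex.norm_real] at hle
  exact ⟨hint.re, (Real.le_norm_self _).trans hle⟩

lemma pairInteraction_neg_opLE_scale_of_norm_integral_le {W : R3 → ℝ} {B : TwoBodyForm} {c : ℝ}
    (h : ∀ ψ ∈ B.dom,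
      Integrable (fun z : R3xR3 => (W (z.fst - z.snd) : ℂ) * ‖ψ z‖ ^ 2) ∧
        ‖∫ z : R3xR3, (W (z.fst - z.snd) : ℂ) * ‖ψ z‖ ^ 2‖ ≤ c * B.val ψ) :
    (pairInteraction fun x => -W x).OpLE (B.scale c) := by
  refine pairInteraction_opLE_scale_of_norm_integral_le fun ψ hψ => ?_
  simp only [Complex.ofReal_neg, neg_mul, integral_neg, norm_neg]
  exact ⟨(h ψ hψ).1.neg, (h ψ hψ).2⟩

theorem lemma9_general {E F : Type*} [NormedAddCommGroup E] [InnerProductSpace ℝ E]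
    [FiniteDimensional ℝ E] [MeasurableSpace E] [BorelSpace E] [NormedAddCommGroup F]
    [InnerProductSpace ℂ F] [CompleteSpace F] {s t : ℝ} (hs : 0 ≤ s) (ht : 0 ≤ t)
    (hst : Module.finrank ℝ E < 2 * (s + t)) :
    ∃ C : ℝ, 0 < C ∧
      ∀ (W : E → ℂ) (hW : MemLp W 2 (volume : Measure E)),
        MemLp (𝓕 (hW.toLp W) : Lp ℂ 2 (volume : Measure E)) ∞ (volume : Measure E) →
          ∀ ψ : Lp F 2 (volume : Measure (WithLp 2 (E × E))),
            Integrable (fun ζ => oneSubLaplacianSymbol ζ.fst ^ s *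
              oneSubLaplacianSymbol ζ.snd ^ t * ‖𝓕 ψ ζ‖ ^ 2) →
            Integrable (fun z : WithLp 2 (E × E) => W (z.fst - z.snd) * ‖ψ z‖ ^ 2) ∧
            ‖∫ z : WithLp 2 (E × E), W (z.fst - z.snd) * ‖ψ z‖ ^ 2‖ ≤
              C * (eLpNorm (𝓕 (hW.toLp W) : Lp ℂ 2 (volume : Measure E)) ∞ volume).toReal *
                ∫ ζ, oneSubLaplacianSymbol ζ.fst ^ s * oneSubLaplacianSymbol ζ.snd ^ t *
                  ‖𝓕 ψ ζ‖ ^ 2 := by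
  obtain ⟨K, hK0, hK⟩ := exists_lintegral_inv_oneSubLaplacianSymbol_tensor_le hs ht hst
  have hw : Measurable fun ζ : WithLp 2 (E × E) =>
      oneSubLaplacianSymbol ζ.fst ^ s * oneSubLaplacianSymbol ζ.snd ^ t := by fun_prop
  have hw0 (ζ : WithLp 2 (E × E)) :
      0 < oneSubLaplacianSymbol ζ.fst ^ s * oneSubLaplacianSymbol ζ.snd ^ t :=
    mul_pos (Real.rpow_pos_of_pos (oneSubLaplacianSymbol_pos _) s)
      (Real.rpow_pos_of_pos (oneSubLaplacianSymbol_pos _) t)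
  refine ⟨K, hK0, fun W hW hWF ψ hψ =>
    ⟨integrable_relativePosition_mul hw hw0 hK hW hψ, ?_⟩⟩
  refine (norm_integral_relativePosition_mul_le hw hw0 hK hW
    (ae_norm_le_toReal_eLpNorm_top hWF.2.ne) hψ).trans_eq ?_
  ring

theorem lemma9 (ε : ℝ) (hε : 0 < ε) :
    ∃ C : ℝ, 0 < C ∧
      ∀ (W : R3 → ℝ) (hW : MemLp W 2 (volume : Measure R3)),
        MemLp (fourierL2 W hW) ∞ (volume : Measure R3) →
          (pairInteraction W).OpLE
            ((oneSubLaplacianPowTensor (3 / 4 + ε) (3 / 4 + ε)).scale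
              (C * (eLpNorm (fourierL2 W hW) ∞ (volume : Measure R3)).toReal)) ∧
          (pairInteraction (fun x => -W x)).OpLE
            ((oneSubLaplacianPowTensor (3 / 4 + ε) (3 / 4 + ε)).scale
              (C * (eLpNorm (fourierL2 W hW) ∞ (volume : Measure R3)).toReal)) := by
  obtain ⟨C, hC, h⟩ := lemma9_general (E := R3) (F := ℂ) (s := 3 / 4 + ε) (t := 3 / 4 + ε)
    (by linarith) (by linarith) (by rw [finrank_euclideanSpace_fin]; push_cast; linarith)
  exact ⟨C, hC, fun W hW hWF =>
    ⟨pairInteraction_opLE_scale_of_norm_integral_le (h _ hW.ofReal hWF),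
      pairInteraction_neg_opLE_scale_of_norm_integral_le (h _ hW.ofReal hWF)⟩⟩
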